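/- **Bounded equivalence and shiftable functions.** Let $\mathcal I$ be a nonempty linearly ordered domain that is effectively given: its elements are coded as inputs of algorithms, the order $<$ is decidable, and, given $n\in\mathbb N$ and constants $a,b\in\mathcal I$, it is decidable whether at least $n$ elements of $\mathcal I$ lie strictly between $a$ and $b$ (likewise with $a$, $b$ or both bounds missing). With the usual coding, $\mathbb Z$ and $\mathbb Q$ are such domains. Let $\alpha$ be a $k$-ary aggregation function over $\mathcal I$, i.e. a function that maps finite bags of $k$-tuples over $\mathcal I$ to values in an arbitrary set, such that, given two bags $B,B'$ of tuples of constants, it is decidable whether $\alpha(B)=\alpha(B')$ (as is the case if $\alpha$ is computable). Call $\alpha$ *shiftable* if for all $D,D'\subseteq\mathcal I$, all strictly monotonic $\varphi\colon D\to D'$ and all bags $B,B'$ with elements in $D^k$ one has $\alpha(B)=\alpha(B')\iff\alpha(\varphi(B))=\alpha(\varphi(B'))$. A *disjunctive $\alpha$-query with comparisons over $\mathcal I$* has the form $q(\bar x,\alpha(\bar y))\leftarrow A_1\vee\dots\vee A_n$, where $\bar x$ and $\bar y$ are tuples of variables, $\bar y$ of length $k$, and each $A_i$ is a finite conjunction of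 relational atoms, negated relational atoms and comparisons $s\mathrel\rho t$, $\rho\in\{<,\le,=,\ne,\ge,>\}$, over variables and constants from $\mathcal I$. It is *safe*: in every $A_i$, each variable of $A_i$, $\bar x$, $\bar y$ is limited, i.e. it occurs in a positive relational atom of $A_i$ or is equated in $A_i$ with a constant or with a limited variable. A *database* $\mathcal D$ is a finite set of ground relational atoms over $\mathcal I$; its *carrier* is the set of constants occurring in it. For a tuple $\bar d$ let $B_{\bar d}$ be the bag of all $\gamma(\bar y)$, where $i$ ranges over $1,\dots,n$ and $\gamma$ over the assignments of the variables of $A_i$ in $\mathcal I$ that satisfy $A_i$ over $\mathcal D$ and have $\gamma(\bar x)=\bar d$ (different disjuncts count separately). The result is $q^{\mathcal D}=\{(\bar d,\alpha(B_{\bar d})) : B_{\bar d}\neq\emptyset\}$. For $N\in\mathbb N$, queries $q$ and $q'$ are *$N$-equivalent* if $q^{\mathcal D}=q'^{\mathcal D}$ for all databases $\mathcal D$ whose carrier has at most $N$ elements. If $\alpha$ is shiftable, then the bounded equivalence problem for disjunctive $\alpha$-queries with comparisons over $\mathcal I$ is decidable: there is an algorithm that, given $N>0$ and two such queries $q,q'$,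 decides whether $q$ and $q'$ are $N$-equivalent. -/

import Mathlib

namespace AggQuery

/-! ### Syntax -/

/-- A term is a variable (named by a natural number) or a constant of the domain `I`. -/
inductive Term (I : Type*) where
  | var (v : ℕ)
  | const (c : I)

/-- The comparison predicates. -/
inductive Comp where
  | lt | le | eq | ne | ge | gt

/-- A relational atom `p(t₁, …, tₙ)`. A predicate symbol is a name together with an arity, the
latter being the length of `args`. -/
structure RelAtom (I : Type*) where
  pred : ℕ
  args : List (Term I)

/-- An ordering atom `lhs ρ rhs`. -/
structure OrdAtom (I : Type*) where
  lhs : Term I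
  rel : Comp
  rhs : Term I

/-- A condition: a conjunction of positive relational atoms, negated relational atoms and
comparisons. -/
structure Condition (I : Type*) where
  pos : List (RelAtom I)
  neg : List (RelAtom I)
  comps : List (OrdAtom I)

/-- A disjunctive aggregate query `q(x̄, α(ȳ)) ← A₁ ∨ ⋯ ∨ Aₙ` with grouping variables
`x̄ = grouping` and aggregation variables `ȳ = agg`, where `α` is `k`-ary. -/
structure Query (I : Type*) (k : ℕ) where
  grouping : List ℕ
  agg : Fin k → ℕ
  disjuncts : List (Condition I)

/-! ### Queries as inputs of algorithms: the evident codings -/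

section Coding

variable {I : Type*} {k : ℕ}

def Term.equiv : Term I ≃ ℕ ⊕ I where
  toFun
    | .var v => .inl v
    | .const c => .inr c
  invFun
    | .inl v => .var v
    | .inr c => .const c
  left_inv t := by cases t <;> rfl
  right_inv t := by cases t <;> rfl

def Comp.equiv : Comp ≃ Fin 6 where
  toFun
    | .lt => 0
    | .le => 1
    | .eq => 2
    | .ne => 3
    | .ge => 4
    | .gt => 5
  invFun
    | 0 => .lt
    | 1 => .le
    | 2 => .eq
    | 3 => .ne
    | 4 => .ge
    | 5 => .gt
  left_inv c := by cases c <;> rfl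
  right_inv i := by fin_cases i <;> rfl

def RelAtom.equiv : RelAtom I ≃ ℕ × List (Term I) where
  toFun a := (a.pred, a.args)
  invFun p := ⟨p.1, p.2⟩
  left_inv _ := rfl
  right_inv _ := rfl

def OrdAtom.equiv : OrdAtom I ≃ Term I × Comp × Term I where
  toFun a := (a.lhs, a.rel, a.rhs)
  invFun p := ⟨p.1, p.2.1, p.2.2⟩
  left_inv _ := rfl
  right_inv _ := rfl

def Condition.equiv :
    Condition I ≃ List (RelAtom I) × List (RelAtom I) × List (OrdAtom I) where
  toFun A := (A.pos, A.neg, A.comps)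
  invFun p := ⟨p.1, p.2.1, p.2.2⟩
  left_inv _ := rfl
  right_inv _ := rfl

def Query.equiv : Query I k ≃ List ℕ × (Fin k → ℕ) × List (Condition I) where
  toFun q := (q.grouping, q.agg, q.disjuncts)
  invFun p := ⟨p.1, p.2.1, p.2.2⟩
  left_inv _ := rfl
  right_inv _ := rfl

instance [Primcodable I] : Primcodable (Term I) := Primcodable.ofEquiv _ Term.equiv

instance : Primcodable Comp := Primcodable.ofEquiv _ Comp.equiv

instance [Primcodable I] : Primcodable (RelAtom I) := Primcodable.ofEquiv _ RelAtom.equiv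

instance [Primcodable I] : Primcodable (OrdAtom I) := Primcodable.ofEquiv _ OrdAtom.equiv

instance [Primcodable I] : Primcodable (Condition I) := Primcodable.ofEquiv _ Condition.equiv

instance [Primcodable I] : Primcodable (Query I k) := Primcodable.ofEquiv _ Query.equiv

end Coding

/-! ### Variables, constants, safety -/

section Syntactic

variable {I : Type*} {k : ℕ}

/-- All terms occurring in a condition. -/
def Condition.terms (A : Condition I) : List (Term I) :=
  A.pos.flatMap RelAtom.args ++ A.neg.flatMap RelAtom.args ++
    A.comps.flatMap fun c => [c.lhs, c.rhs]

/-- The variables occurring in a condition. -/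
def Condition.vars (A : Condition I) : Finset ℕ :=
  (A.terms.flatMap fun t => match t with
    | .var v => [v]
    | .const _ => []).toFinset

/-- The constants occurring in a condition. -/
def Condition.consts [DecidableEq I] (A : Condition I) : Finset I :=
  (A.terms.flatMap fun t => match t with
    | .var _ => []
    | .const c => [c]).toFinset

/-- The equality `s = t`, in one of its two ways of writing, is a conjunct of `A`. -/
def Condition.Equates (A : Condition I) (s t : Term I) : Prop :=
  ⟨s, .eq, t⟩ ∈ A.comps ∨ ⟨t, .eq, s⟩ ∈ A.comps

/-- A variable is limited in a condition if it occurs in a positive relational atom, or is equated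
with a constant or with a limited variable. -/
inductive Condition.Limited (A : Condition I) : ℕ → Prop
  | pos {v : ℕ} {a : RelAtom I} : a ∈ A.pos → .var v ∈ a.args → A.Limited v
  | eqConst {v : ℕ} {c : I} : A.Equates (.var v) (.const c) → A.Limited v
  | eqVar {v w : ℕ} : A.Equates (.var v) (.var w) → A.Limited w → A.Limited v

/-- A query is safe if, in every disjunct, all variables of the disjunct and all variables of the
head are limited. -/
def Query.Safe (q : Query I k) : Prop :=
  ∀ A ∈ q.disjuncts,
    (∀ v ∈ A.vars, A.Limited v) ∧ (∀ v ∈ q.grouping, A.Limited v) ∧ ∀ j, A.Limited (q.agg j)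

end Syntactic

/-! ### Semantics -/

/-- A database: a finite set of ground relational atoms `p(d₁, …, dₙ)`. -/
abbrev Database (I : Type*) := Finset (ℕ × List I)

section Semantics

variable {I : Type*} {k : ℕ}

/-- The carrier of a database: the set of constants occurring in it. -/
def Database.carrier [DecidableEq I] (D : Database I) : Finset I :=
  D.biUnion fun a => a.2.toFinset

/-- The value of a term under an assignment; constants are mapped to themselves. -/
def Term.eval (γ : ℕ → I) : Term I → I
  | .var v => γ v
  | .const c => c

variable [LinearOrder I]

def Comp.Holds : Comp → I → I → Prop
  | .lt, a, b => a < b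
  | .le, a, b => a ≤ b
  | .eq, a, b => a = b
  | .ne, a, b => a ≠ b
  | .ge, a, b => a ≥ b
  | .gt, a, b => a > b

def RelAtom.Holds (D : Database I) (γ : ℕ → I) (a : RelAtom I) : Prop :=
  (a.pred, a.args.map (Term.eval γ)) ∈ D

def OrdAtom.Holds (γ : ℕ → I) (c : OrdAtom I) : Prop :=
  c.rel.Holds (c.lhs.eval γ) (c.rhs.eval γ)

/-- The assignment `γ` satisfies the condition `A` over the database `D`. -/
def Condition.Holds (A : Condition I) (D : Database I) (γ : ℕ → I) : Prop :=
  (∀ a ∈ A.pos, a.Holds D γ) ∧ (∀ a ∈ A.neg, ¬ a.Holds D γ) ∧ ∀ c ∈ A.comps, c.Holds γ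

variable [Nonempty I]

/-- An assignment for the variables of `A`, continued by an irrelevant value to other variables. -/
noncomputable def Condition.extend (A : Condition I) (γ : A.vars → I) (v : ℕ) : I :=
  if h : v ∈ A.vars then γ ⟨v, h⟩ else Classical.arbitrary I

open Classical in
/-- The set of the assignments for the variables of `A` that satisfy `A` over `D`. The values are
taken from the carrier of `D` and the constants of `A`; if all variables of `A` are limited, this
is no restriction (see `Condition.mem_assignments`). -/
noncomputable def Condition.assignments (A : Condition I) (D : Database I) :
    Finset (A.vars → I) :=
  (Fintype.piFinset fun _ => D.carrier ∪ A.consts).filter fun γ => A.Holds D (A.extend γ)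

/-- For a condition all of whose variables are limited, `assignments` consists of all satisfying
assignments. -/
theorem Condition.mem_assignments (A : Condition I) (hA : ∀ v ∈ A.vars, A.Limited v)
    (D : Database I) (γ : A.vars → I) :
    γ ∈ A.assignments D ↔ A.Holds D (A.extend γ) := by
  simp only [Condition.assignments, Finset.mem_filter, Fintype.mem_piFinset,
    and_iff_right_iff_imp]
  intro h
  have key : ∀ v, A.Limited v → A.extend γ v ∈ D.carrier ∪ A.consts := by
    intro v hv
    induction hv with
    | @pos v a ha hva =>
      refine Finset.mem_union_left _ (Finset.mem_biUnion.2 ⟨_, h.1 a ha, ?_⟩)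
      exact List.mem_toFinset.2 (List.mem_map.2 ⟨_, hva, rfl⟩)
    | @eqConst v c hc =>
      have e : A.extend γ v = c := by
        rcases hc with hc | hc
        · exact h.2.2 _ hc
        · exact (h.2.2 _ hc : c = A.extend γ v).symm
      refine Finset.mem_union_right _ (List.mem_toFinset.2 (List.mem_flatMap.2
        ⟨.const c, ?_, by simp [e]⟩))
      rcases hc with hc | hc
      all_goals
        exact List.mem_append_right _ (List.mem_flatMap.2 ⟨_, hc, by simp⟩)
    | @eqVar v w hvw _ ih =>
      have e : A.extend γ v = A.extend γ w := by
        rcases hvw with hc | hc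
        · exact h.2.2 _ hc
        · exact (h.2.2 _ hc : A.extend γ w = A.extend γ v).symm
      rwa [e]
  rintro ⟨v, hv⟩
  simpa [Condition.extend, hv] using key v (hA v hv)

/-- The bag collected by `q` over `D` for the group `d`: for every disjunct and every assignment
`γ` that satisfies the disjunct and maps the grouping variables to `d`, it contains the tuple
`γ(ȳ)`. Assignments for different disjuncts count separately. -/
noncomputable def Query.bag (q : Query I k) (D : Database I) (d : List I) :
    Multiset (Fin k → I) :=
  (q.disjuncts.map fun A =>
    (((A.assignments D).filter fun γ => q.grouping.map (A.extend γ) = d).val.map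
      fun γ j => A.extend γ (q.agg j))).sum

/-- The result `q^D` of a query with the aggregation function `α` over the database `D`: one pair
`(d, α(bag of d))` for each group `d` that has at least one satisfying assignment. -/
def Query.result {V : Type*} (α : Multiset (Fin k → I) → V) (q : Query I k) (D : Database I) :
    Set (List I × V) :=
  {r | q.bag D r.1 ≠ 0 ∧ r.2 = α (q.bag D r.1)}

/-- `q` and `q'` are `N`-equivalent: they return the same result over all databases whose carrier
has at most `N` elements. -/
def NEquivalent {V : Type*} (α : Multiset (Fin k → I) → V) (N : ℕ) (q q' : Query I k) : Prop :=
  ∀ D : Database I, D.carrier.card ≤ N → q.result α D = q'.result α D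

/-- The bounded equivalence problem for disjunctive `α`-queries is decidable: there is an algorithm
that, given `N > 0` and safe queries `q`, `q'`, decides whether they are `N`-equivalent. -/
def BoundedEquivalenceDecidable [Primcodable I] {V : Type*}
    (α : Multiset (Fin k → I) → V) : Prop :=
  ∃ f : ℕ × Query I k × Query I k → Bool, Computable f ∧
    ∀ (N : ℕ) (q q' : Query I k), 0 < N → q.Safe → q'.Safe →
      (f (N, q, q') = true ↔ NEquivalent α N q q')

end Semantics

/-! ### Aggregation functions and domains -/

/-- `α` is shiftable: for all `D, D' ⊆ I`, all strictly monotonic `φ : D → D'` and all bags `B`,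
`B'` with elements in `D^k`, `α(B) = α(B')` if and only if `α(φ(B)) = α(φ(B'))`. -/
def Shiftable {I : Type*} [LinearOrder I] {k : ℕ} {V : Type*}
    (α : Multiset (Fin k → I) → V) : Prop :=
  ∀ (D D' : Set I) (φ : D → D'), StrictMono φ → ∀ B B' : Multiset (Fin k → D),
    (α (B.map fun t j => (t j : I)) = α (B'.map fun t j => (t j : I)) ↔
      α (B.map fun t j => (φ (t j) : I)) = α (B'.map fun t j => (φ (t j) : I)))

/-- It is decidable whether `α` takes the same value on two given bags of tuples of constants. This
holds in particular if `α` is computable with values in a type such as `ℕ`, `ℤ` or `ℚ`. -/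
def EffectiveAggregation {I : Type*} [Primcodable I] {k : ℕ} {V : Type*}
    (α : Multiset (Fin k → I) → V) : Prop :=
  ComputablePred fun p : List (Fin k → I) × List (Fin k → I) =>
    α (p.1 : Multiset (Fin k → I)) = α (p.2 : Multiset (Fin k → I))

/-- The ordered domain `I` is effectively given: the order is decidable, and so is whether there
are at least `n` elements strictly between two given constants, below a given constant, above a
given constant, or in all of `I` (`none` stands for a missing bound). -/
structure EffectiveOrder (I : Type*) [LinearOrder I] [Primcodable I] : Prop where
  lt : ComputablePred fun p : I × I => p.1 < p.2
  between : ComputablePred fun p : ℕ × Option I × Option I =>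
    ∃ s : Finset I, s.card = p.1 ∧
      ∀ x ∈ s, (∀ a, p.2.1 = some a → a < x) ∧ (∀ b, p.2.2 = some b → x < b)

end AggQuery

/-! Whether a condition holds depends only on the order type of the carrier relative to the
constants of the query. Let `φ` be strictly monotonic on a set that contains the carrier of `D` and
these constants, and let it fix the constants. Then `φ` carries the satisfying assignments over `D`
bijectively to those over `φ(D)`, and so the bag of a group `d` to the bag of `φ(d)`
(`FixingEmbedding.bag_map`). Shiftability then turns agreement of the two queries over `φ(D)` into
agreement over `D` (`FixingEmbedding.result_eq`).

It therefore suffices to test databases over one finite list `S` into which every set of at most `N`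
elements embeds in this way. For this, `S` must contain the constants and, in every interval bounded
by constants or unbounded, `N` elements or as many as the domain has there (`Adequate`,
`Adequate.exists_fixingEmbedding`). Such a list exists (`exists_adequate`), and adequacy is
decidable because the order is effective, so a list is found by unbounded search
(`ComputablePred.exists_choice`). Predicate symbols absent from both queries do not influence safe
queries (`Query.bag_filter`), which leaves finitely many databases over `S`. Each of them is tested
by evaluating both queries on lists and comparing the aggregates. -/

section Toolkit

/-! ### Closure properties of computable functions and decidable predicates -/

variable {α β σ : Type*} [Primcodable α] [Primcodable β] [Primcodable σ]

/-- A fold is a recursion over the positions of the list whose step looks up the current entry;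
after `n` steps it has folded the first `n` entries. -/
theorem Computable.list_foldl {f : α → List β} {g : α → σ} {h : α → σ × β → σ}
    (hf : Computable f) (hg : Computable g) (hh : Computable₂ h) :
    Computable fun a => (f a).foldl (fun s b => h a (s, b)) (g a) := by
  have step : Computable₂ fun (a : α) (p : ℕ × σ) =>
      (Option.casesOn (f a)[p.1]? p.2 (fun b => h a (p.2, b)) : σ) := by
    refine Computable.option_casesOn
      (Computable.list_getElem?.comp (hf.comp .fst) (Computable.fst.comp .snd))
      (Computable.snd.comp .snd) ?_
    exact hh.comp (Computable.fst.comp .fst) ((Computable.snd.comp (Computable.snd.comp .fst)).pair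
      .snd)
  refine (Computable.nat_rec (Computable.list_length.comp hf) hg step).of_eq fun a => ?_
  have key : ∀ n, n ≤ (f a).length →
      (Nat.rec (g a) (fun y IH => (Option.casesOn (f a)[y]? IH (fun b => h a (IH, b)) : σ)) n : σ) =
        ((f a).take n).foldl (fun s b => h a (s, b)) (g a) := by
    intro n
    induction n with
    | zero => simp
    | succ n ih =>
      intro hn
      have hn' : n < (f a).length := hn
      simp only [ih hn'.le, List.getElem?_eq_getElem hn', List.take_add_one, List.foldl_append]
      simp
  have := key _ le_rfl
  rwa [List.take_length] at this

theorem Computable.list_foldr {f : α → List β} {g : α → σ} {h : α → β × σ → σ}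
    (hf : Computable f) (hg : Computable g) (hh : Computable₂ h) :
    Computable fun a => (f a).foldr (fun b s => h a (b, s)) (g a) := by
  have hh' : Computable₂ fun (a : α) (p : σ × β) => h a (p.2, p.1) :=
    hh.comp .fst ((Computable.snd.comp .snd).pair (Computable.fst.comp .snd))
  exact (Computable.list_foldl (Computable.list_reverse.comp hf) hg hh').of_eq fun a => by simp

theorem Computable.list_map {f : α → List β} {g : α → β → σ}
    (hf : Computable f) (hg : Computable₂ g) : Computable fun a => (f a).map (g a) := by
  have hh : Computable₂ fun (a : α) (p : β × List σ) => g a p.1 :: p.2 :=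
    Computable.list_cons.comp (hg.comp .fst (Computable.fst.comp .snd)) (Computable.snd.comp .snd)
  exact (Computable.list_foldr hf (Computable.const []) hh).of_eq fun a => by
    induction f a <;> simp_all

theorem Computable.list_flatMap {f : α → List β} {g : α → β → List σ}
    (hf : Computable f) (hg : Computable₂ g) : Computable fun a => (f a).flatMap (g a) := by
  have hh : Computable₂ fun (a : α) (p : β × List σ) => g a p.1 ++ p.2 :=
    Computable.list_append.comp (hg.comp .fst (Computable.fst.comp .snd)) (Computable.snd.comp .snd)
  exact (Computable.list_foldr hf (Computable.const []) hh).of_eq fun a => by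
    induction f a <;> simp_all

theorem ComputablePred.decide_comp {p : α → Prop} (hp : ComputablePred p) [DecidablePred p] :
    Computable fun a => decide (p a) := by
  obtain ⟨_, h⟩ := hp
  exact h.of_eq fun a => by congr

theorem ComputablePred.comp {p : β → Prop} (hp : ComputablePred p) {f : α → β}
    (hf : Computable f) : ComputablePred fun a => p (f a) := by
  obtain ⟨_, h⟩ := hp
  exact ⟨fun a => inferInstance, h.comp hf⟩

theorem ComputablePred.conj {p q : α → Prop} (hp : ComputablePred p) (hq : ComputablePred q) :
    ComputablePred fun a => p a ∧ q a := by
  classical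
  exact ⟨inferInstance, (Primrec.and.to_comp.comp hp.decide_comp hq.decide_comp).of_eq
    fun a => by simp⟩

theorem ComputablePred.disj {p q : α → Prop} (hp : ComputablePred p) (hq : ComputablePred q) :
    ComputablePred fun a => p a ∨ q a := by
  classical
  exact ⟨inferInstance, (Primrec.or.to_comp.comp hp.decide_comp hq.decide_comp).of_eq
    fun a => by simp⟩

theorem ComputablePred.neg {p : α → Prop} (hp : ComputablePred p) :
    ComputablePred fun a => ¬ p a := by
  classical
  exact ⟨inferInstance, (Primrec.not.to_comp.comp hp.decide_comp).of_eq fun a => by simp⟩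

theorem ComputablePred.imp {p q : α → Prop} (hp : ComputablePred p) (hq : ComputablePred q) :
    ComputablePred fun a => p a → q a :=
  (hp.neg.disj hq).of_eq fun a => by tauto

theorem Computable.pred_eq {f g : α → β} (hf : Computable f) (hg : Computable g) :
    ComputablePred fun a => f a = g a := by
  classical
  exact ⟨inferInstance, ((Primrec.eq (α := β)).decide.to_comp.comp hf hg).of_eq
    fun a => by congr⟩

theorem Computable.ite {p : α → Prop} [DecidablePred p] {f g : α → σ} (hp : ComputablePred p)
    (hf : Computable f) (hg : Computable g) : Computable fun a => if p a then f a else g a :=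
  (Computable.cond hp.decide_comp hf hg).of_eq fun a => by
    by_cases h : p a <;> simp [h]

theorem Computable.list_filter {f : α → List β} {p : α → β → Prop} [∀ a, DecidablePred (p a)]
    (hf : Computable f) (hp : ComputablePred fun x : α × β => p x.1 x.2) :
    Computable fun a => (f a).filter fun b => p a b := by
  have hh : Computable₂ fun (a : α) (x : β × List β) => if p a x.1 then x.1 :: x.2 else x.2 :=
    Computable.ite (p := fun y : α × β × List β => p y.1 y.2.1)
      (hp.comp (f := fun y : α × β × List β => (y.1, y.2.1))
        (Computable.fst.pair (Computable.fst.comp .snd)))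
      (Computable.list_cons.comp (Computable.fst.comp .snd) (Computable.snd.comp .snd))
      (Computable.snd.comp .snd)
  refine (Computable.list_foldr hf (Computable.const []) hh).of_eq fun a => ?_
  induction f a with
  | nil => simp
  | cons b l ih => by_cases h : p a b <;> simp [h, ih]

theorem ComputablePred.forall_mem_list {f : α → List β} {p : α → β → Prop} (hf : Computable f)
    (hp : ComputablePred fun x : α × β => p x.1 x.2) :
    ComputablePred fun a => ∀ b ∈ f a, p a b := by
  classical
  refine (Computable.pred_eq (Computable.list_filter (p := fun a b => ¬ p a b) hf hp.neg)
    (Computable.const [])).of_eq fun a => ?_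
  simp [List.filter_eq_nil_iff]

theorem ComputablePred.exists_mem_list {f : α → List β} {p : α → β → Prop} (hf : Computable f)
    (hp : ComputablePred fun x : α × β => p x.1 x.2) :
    ComputablePred fun a => ∃ b ∈ f a, p a b :=
  (ComputablePred.forall_mem_list (p := fun a b => ¬ p a b) hf hp.neg).neg.of_eq fun a => by
    push Not; rfl

theorem ComputablePred.mem_list {f : α → β} {g : α → List β} (hf : Computable f)
    (hg : Computable g) : ComputablePred fun a => f a ∈ g a :=
  (ComputablePred.exists_mem_list (p := fun a b => f a = b) hg
    (Computable.pred_eq (hf.comp .fst) .snd)).of_eq fun a => by simp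

theorem Computable.list_dedup [DecidableEq β] : Computable (List.dedup : List β → List β) := by
  have hh : Computable₂ fun (_ : List β) (x : β × List β) =>
      if x.1 ∈ x.2 then x.2 else x.1 :: x.2 :=
    Computable.ite (p := fun y : List β × β × List β => y.2.1 ∈ y.2.2)
      (ComputablePred.mem_list (Computable.fst.comp .snd) (Computable.snd.comp .snd))
      (Computable.snd.comp .snd)
      (Computable.list_cons.comp (Computable.fst.comp .snd) (Computable.snd.comp .snd))
  refine (Computable.list_foldr Computable.id (Computable.const []) hh).of_eq fun l => ?_
  induction l with
  | nil => simp
  | cons b l ih =>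
    simp only [id] at ih
    by_cases h : b ∈ l
    · simp [ih, h, List.dedup_cons_of_mem]
    · simp [ih, h, List.dedup_cons_of_notMem]

theorem Computable.list_sublists' : Computable (List.sublists' : List β → List (List β)) := by
  have hh : Computable₂ fun (_ : List β) (x : β × List (List β)) =>
      x.2 ++ x.2.map (List.cons x.1) :=
    Computable.list_append.comp (Computable.snd.comp .snd)
      (Computable.list_map (g := fun (y : List β × β × List (List β)) l => y.2.1 :: l)
        (Computable.snd.comp .snd)
        (Computable.list_cons.comp (Computable.fst.comp (Computable.snd.comp .fst)) .snd))
  refine (Computable.list_foldr Computable.id (Computable.const [[]]) hh).of_eq fun l => ?_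
  induction l with
  | nil => simp
  | cons b l ih => simp only [id] at ih; simp [ih]

/-- Unbounded search: run through the codes of elements of `β` and return the first one that
satisfies the predicate. The existence hypothesis makes the search terminate. -/
theorem ComputablePred.exists_choice {p : α → β → Prop}
    (hp : ComputablePred fun x : α × β => p x.1 x.2) (h : ∀ a, ∃ b, p a b) :
    ∃ g : α → β, Computable g ∧ ∀ a, p a (g a) := by
  classical
  have hd : Computable₂ fun (a : α) (n : ℕ) =>
      (Encodable.decode (α := β) n).bind fun b => if p a b then some b else none :=
    Computable.option_bind (f := fun x : α × ℕ => Encodable.decode (α := β) x.2)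
      (g := fun x b => if p x.1 b then some b else none)
      (Computable.decode.comp .snd)
      (Computable.ite (p := fun y : (α × ℕ) × β => p y.1.1 y.2)
        (hp.comp (f := fun y : (α × ℕ) × β => (y.1.1, y.2))
          ((Computable.fst.comp .fst).pair .snd))
        (Computable.option_some.comp .snd) (Computable.const none))
  have hr := Partrec.rfindOpt hd
  have dom : ∀ a, (Nat.rfindOpt fun n => (Encodable.decode (α := β) n).bind
      fun b => if p a b then some b else none).Dom := by
    intro a
    obtain ⟨b, hb⟩ := h a
    exact Nat.rfindOpt_dom.2 ⟨Encodable.encode b, b, by simp [hb]⟩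
  refine ⟨fun a => (Nat.rfindOpt _).get (dom a), hr.of_eq_tot fun a => Part.get_mem _, fun a => ?_⟩
  obtain ⟨n, hn⟩ := Nat.rfindOpt_spec (Part.get_mem (dom a))
  simp only [Option.mem_def, Option.bind_eq_some_iff] at hn
  obtain ⟨b, -, hb⟩ := hn
  split_ifs at hb with h'
  rwa [Option.some_inj.1 hb] at h'

-- Composition rules that let `fun_prop` prove computability

attribute [fun_prop] Computable

variable {γ : Type*} [Primcodable γ]

@[fun_prop]
theorem Computable.fun_id : Computable fun a : α => a := .id

@[fun_prop]
theorem Computable.fun_comp {f : β → σ} {g : α → β} (hf : Computable f) (hg : Computable g) :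
    Computable fun a => f (g a) := hf.comp hg

attribute [fun_prop] Computable.const Computable.pair

@[fun_prop]
theorem Computable.fun_fst {f : α → β × γ} (hf : Computable f) : Computable fun a => (f a).1 :=
  Computable.fst.comp hf

@[fun_prop]
theorem Computable.fun_snd {f : α → β × γ} (hf : Computable f) : Computable fun a => (f a).2 :=
  Computable.snd.comp hf

@[fun_prop]
theorem Computable.fun_append {f g : α → List β} (hf : Computable f) (hg : Computable g) :
    Computable fun a => f a ++ g a := Computable.list_append.comp hf hg

@[fun_prop]
theorem Computable.fun_cons {f : α → β} {g : α → List β} (hf : Computable f)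
    (hg : Computable g) : Computable fun a => f a :: g a := Computable.list_cons.comp hf hg

@[fun_prop]
theorem Computable.fun_length {f : α → List β} (hf : Computable f) :
    Computable fun a => (f a).length := Computable.list_length.comp hf

@[fun_prop]
theorem Computable.fun_some {f : α → β} (hf : Computable f) :
    Computable fun a => some (f a) := Computable.option_some.comp hf

@[fun_prop]
theorem Computable.fun_map {f : α → List β} {g : α → β → σ} (hf : Computable f)
    (hg : Computable fun x : α × β => g x.1 x.2) : Computable fun a => (f a).map (g a) :=
  Computable.list_map hf hg

@[fun_prop]
theorem Computable.fun_flatMap {f : α → List β} {g : α → β → List σ} (hf : Computable f)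
    (hg : Computable fun x : α × β => g x.1 x.2) : Computable fun a => (f a).flatMap (g a) :=
  Computable.list_flatMap hf hg

@[fun_prop]
theorem Computable.fun_dedup [DecidableEq β] {f : α → List β} (hf : Computable f) :
    Computable fun a => (f a).dedup := Computable.list_dedup.comp hf

@[fun_prop]
theorem Computable.fun_sublists' {f : α → List β} (hf : Computable f) :
    Computable fun a => (f a).sublists' := Computable.list_sublists'.comp hf

@[fun_prop]
theorem Computable.fun_range {f : α → ℕ} (hf : Computable f) :
    Computable fun a => List.range (f a) := Primrec.list_range.to_comp.comp hf

@[fun_prop]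
theorem Computable.fun_add {f g : α → ℕ} (hf : Computable f) (hg : Computable g) :
    Computable fun a => f a + g a := Primrec.nat_add.to_comp.comp hf hg

@[fun_prop]
theorem Computable.fun_idxOf [DecidableEq β] {f : α → β} {g : α → List β} (hf : Computable f)
    (hg : Computable g) : Computable fun a => (g a).idxOf (f a) :=
  Primrec.list_idxOf.to_comp.comp hf hg

@[fun_prop]
theorem Computable.fun_getD {f : α → List β} {g : α → ℕ} (hf : Computable f)
    (hg : Computable g) (d : β) : Computable fun a => (f a).getD (g a) d :=
  (Primrec.list_getD d).to_comp.comp hf hg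

/-- Functions on `Fin k` are coded as vectors of length `k`, and a vector with computable entries is
computable. -/
theorem Computable.fin_arrow {k : ℕ} {f : α → Fin k → β} (hf : ∀ j, Computable fun a => f a j) :
    Computable f := by
  have h := Computable.vector_ofFn hf
  have e : Computable (Equiv.vectorEquivFin β k).symm.symm :=
    (Primrec.of_equiv_symm (e := (Equiv.vectorEquivFin β k).symm)).to_comp
  refine (e.comp h).of_eq fun a => ?_
  funext j
  simp [Equiv.vectorEquivFin]

theorem ComputablePred.nat_le {f g : α → ℕ} (hf : Computable f) (hg : Computable g) :
    ComputablePred fun a => f a ≤ g a := by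
  classical
  exact ⟨inferInstance, (Primrec.nat_le.decide.to_comp.comp hf hg).of_eq fun a => by congr⟩

end Toolkit

/-! ### Enumeration of words over a finite alphabet -/

section Words

variable {α β : Type*}

/-- The words of length `n` over a given list of letters. -/
def List.words (U : List α) : ℕ → List (List α)
  | 0 => [[]]
  | n + 1 => U.flatMap fun x => (U.words n).map fun w => x :: w

theorem List.mem_words {U : List α} {n : ℕ} {w : List α} :
    w ∈ U.words n ↔ w.length = n ∧ ∀ x ∈ w, x ∈ U := by
  induction n generalizing w with
  | zero => cases w <;> simp [List.words]
  | succ n ih => cases w <;> (simp [List.words, ih]; try tauto)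

/-- Needed because satisfying assignments are counted with multiplicity: none may be enumerated
twice. -/
theorem List.nodup_words {U : List α} (hU : U.Nodup) (n : ℕ) : (U.words n).Nodup := by
  induction n with
  | zero => simp [List.words]
  | succ n ih =>
    refine List.nodup_flatMap.2 ⟨fun x _ => ih.map fun a b h => (List.cons.inj h).2, ?_⟩
    refine hU.imp fun {x y} hxy => ?_
    simp only [Function.onFun, List.disjoint_left, List.mem_map]
    rintro _ ⟨a, -, rfl⟩ ⟨b, -, h⟩
    exact hxy (List.cons.inj h).1.symm

@[fun_prop]
theorem Computable.fun_words [Primcodable α] [Primcodable β] {f : α → List β} {g : α → ℕ}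
    (hf : Computable f) (hg : Computable g) : Computable fun a => (f a).words (g a) := by
  have step : Computable fun x : α × ℕ × List (List β) =>
      (f x.1).flatMap fun y => x.2.2.map fun w => y :: w := by fun_prop
  refine (Computable.nat_rec hg (Computable.const [[]]) step.to₂).of_eq fun a => ?_
  induction g a with
  | zero => rfl
  | succ n ih => simp only [ih]; rfl

end Words

namespace AggQuery

/-! ### Query evaluation on lists and the finite test -/

section Syntactic

variable {I : Type*} {k : ℕ}

/-- The variables of a term. -/
def Term.varList : Term I → List ℕ
  | .var v => [v]
  | .const _ => []

/-- The constants of a term. -/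
def Term.constList : Term I → List I
  | .var _ => []
  | .const c => [c]

/-- The variables of a condition, each listed once. -/
def Condition.varList (A : Condition I) : List ℕ := (A.terms.flatMap Term.varList).dedup

/-- The constants of a condition. -/
def Condition.constList (A : Condition I) : List I := A.terms.flatMap Term.constList

/-- The assignment that gives the values `w` to the variables of `A`. -/
noncomputable def Condition.assign [Nonempty I] (A : Condition I) (w : List I) (v : ℕ) : I :=
  w.getD (A.varList.idxOf v) (Classical.arbitrary I)

/-- The predicate symbols of a condition. -/
def Condition.signature (A : Condition I) : List (ℕ × ℕ) :=
  (A.pos ++ A.neg).map fun a => (a.pred, a.args.length)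

def Query.signature (q : Query I k) : List (ℕ × ℕ) := q.disjuncts.flatMap Condition.signature

def Query.constList (q : Query I k) : List I := q.disjuncts.flatMap Condition.constList

/-- The ground atoms with a predicate symbol from `sig` and arguments from `U`. -/
def groundAtoms (sig : List (ℕ × ℕ)) (U : List I) : List (ℕ × List I) :=
  sig.flatMap fun s => (U.words s.2).map fun w => (s.1, w)

end Syntactic

section Algorithm

variable {I : Type*} {k : ℕ} [LinearOrder I] [Nonempty I]

/-- The values that assignments for `A` over the database with atoms `L` may take. -/
def Condition.range (A : Condition I) (L : List (ℕ × List I)) : List I :=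
  ((L.flatMap fun a => a.2) ++ A.constList).dedup

open Classical in
/-- The satisfying assignments for `A` over the database with atoms `L`. -/
noncomputable def Condition.solutions (A : Condition I) (L : List (ℕ × List I)) :
    List (List I) :=
  ((A.range L).words A.varList.length).filter fun w => A.Holds L.toFinset (A.assign w)

/-- The pairs of a group and a tuple that are collected by `q` over the database with
atoms `L`. -/
noncomputable def Query.answers (q : Query I k) (L : List (ℕ × List I)) :
    List (List I × (Fin k → I)) :=
  q.disjuncts.flatMap fun A => (A.solutions L).map fun w =>
    (q.grouping.map (A.assign w), fun j => A.assign w (q.agg j))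

noncomputable def Query.bagList (q : Query I k) (L : List (ℕ × List I)) (d : List I) :
    List (Fin k → I) :=
  ((q.answers L).filter fun r => r.1 = d).map fun r => r.2

/-- `q` and `q'` have the same result over the database with atoms `L`. -/
def AgreeOn {V : Type*} (α : Multiset (Fin k → I) → V) (q q' : Query I k)
    (L : List (ℕ × List I)) : Prop :=
  ∀ r ∈ q.answers L ++ q'.answers L, q.bagList L r.1 ≠ [] ∧ q'.bagList L r.1 ≠ [] ∧
    α (q.bagList L r.1 : Multiset (Fin k → I)) = α (q'.bagList L r.1 : Multiset (Fin k → I))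

/-- The elements of `S` between two bounds. -/
def listBetween (S : List I) (a b : Option I) : List I :=
  S.filter fun x => (∀ c ∈ a.toList, c < x) ∧ (∀ c ∈ b.toList, x < c)

/-- `S` contains `C`, and `N` elements, or as many as there are in `I`, in every interval whose
bounds are in `C` or missing. -/
def Adequate (N : ℕ) (C S : List I) : Prop :=
  (∀ c ∈ C, c ∈ S) ∧
    ∀ a ∈ none :: C.map some, ∀ b ∈ none :: C.map some, ∀ n ∈ List.range (N + 1),
      (∃ s : Finset I, s.card = n ∧
        ∀ x ∈ s, (∀ c, a = some c → c < x) ∧ (∀ c, b = some c → x < c)) →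
      n ≤ (listBetween S a b).dedup.length

/-- `q` and `q'` agree over all databases with at most `N` constants, all of them from `S`. -/
def EquivalentWithin {V : Type*} (α : Multiset (Fin k → I) → V) (N : ℕ) (q q' : Query I k)
    (S : List I) : Prop :=
  ∀ w ∈ S.words N, ∀ L ∈ (groundAtoms (q.signature ++ q'.signature) w).sublists',
    AgreeOn α q q' L

end Algorithm

/-! ### Computability of query evaluation and of the finite test -/

section Computability

variable {I : Type*} {k : ℕ} [Primcodable I] {σ τ : Type*} [Primcodable σ] [Primcodable τ]

@[fun_prop]
theorem computable_pred {f : σ → RelAtom I} (hf : Computable f) :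
    Computable fun a => (f a).pred :=
  Computable.fst.comp ((Primrec.of_equiv (e := RelAtom.equiv)).to_comp.comp hf)

@[fun_prop]
theorem computable_args {f : σ → RelAtom I} (hf : Computable f) :
    Computable fun a => (f a).args :=
  Computable.snd.comp ((Primrec.of_equiv (e := RelAtom.equiv)).to_comp.comp hf)

@[fun_prop]
theorem computable_lhs {f : σ → OrdAtom I} (hf : Computable f) :
    Computable fun a => (f a).lhs :=
  Computable.fst.comp ((Primrec.of_equiv (e := OrdAtom.equiv)).to_comp.comp hf)

@[fun_prop]
theorem computable_rel {f : σ → OrdAtom I} (hf : Computable f) :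
    Computable fun a => (f a).rel :=
  (Computable.fst.comp .snd).comp ((Primrec.of_equiv (e := OrdAtom.equiv)).to_comp.comp hf)

@[fun_prop]
theorem computable_rhs {f : σ → OrdAtom I} (hf : Computable f) :
    Computable fun a => (f a).rhs :=
  (Computable.snd.comp .snd).comp ((Primrec.of_equiv (e := OrdAtom.equiv)).to_comp.comp hf)

@[fun_prop]
theorem computable_pos {f : σ → Condition I} (hf : Computable f) :
    Computable fun a => (f a).pos :=
  Computable.fst.comp ((Primrec.of_equiv (e := Condition.equiv)).to_comp.comp hf)

@[fun_prop]
theorem computable_neg {f : σ → Condition I} (hf : Computable f) :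
    Computable fun a => (f a).neg :=
  (Computable.fst.comp .snd).comp ((Primrec.of_equiv (e := Condition.equiv)).to_comp.comp hf)

@[fun_prop]
theorem computable_comps {f : σ → Condition I} (hf : Computable f) :
    Computable fun a => (f a).comps :=
  (Computable.snd.comp .snd).comp ((Primrec.of_equiv (e := Condition.equiv)).to_comp.comp hf)

@[fun_prop]
theorem computable_grouping {f : σ → Query I k} (hf : Computable f) :
    Computable fun a => (f a).grouping :=
  Computable.fst.comp ((Primrec.of_equiv (e := Query.equiv)).to_comp.comp hf)

@[fun_prop]
theorem computable_agg {f : σ → Query I k} (hf : Computable f) :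
    Computable fun a => (f a).agg :=
  (Computable.fst.comp .snd).comp ((Primrec.of_equiv (e := Query.equiv)).to_comp.comp hf)

@[fun_prop]
theorem computable_disjuncts {f : σ → Query I k} (hf : Computable f) :
    Computable fun a => (f a).disjuncts :=
  (Computable.snd.comp .snd).comp ((Primrec.of_equiv (e := Query.equiv)).to_comp.comp hf)

theorem computable_termCases {f : σ → Term I} {g : σ → ℕ → τ} {h : σ → I → τ}
    (hf : Computable f) (hg : Computable fun x : σ × ℕ => g x.1 x.2)
    (hh : Computable fun x : σ × I => h x.1 x.2) :
    Computable fun a => (Sum.casesOn (Term.equiv (f a)) (g a) (h a) : τ) :=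
  Computable.sumCasesOn ((Primrec.of_equiv (e := Term.equiv)).to_comp.comp hf) hg hh

@[fun_prop]
theorem computable_termVarList {f : σ → Term I} (hf : Computable f) :
    Computable fun a => (f a).varList :=
  (computable_termCases (g := fun _ v => [v]) (h := fun _ _ => []) hf (by fun_prop)
    (by fun_prop)).of_eq fun a => by cases f a <;> rfl

@[fun_prop]
theorem computable_termConstList {f : σ → Term I} (hf : Computable f) :
    Computable fun a => (f a).constList :=
  (computable_termCases (g := fun _ _ => []) (h := fun _ c => [c]) hf (by fun_prop)
    (by fun_prop)).of_eq fun a => by cases f a <;> rfl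

@[fun_prop]
theorem computable_eval {f : σ → Term I} {g : σ → ℕ → I} (hf : Computable f)
    (hg : Computable fun x : σ × ℕ => g x.1 x.2) :
    Computable fun a => (f a).eval (g a) :=
  (computable_termCases (g := g) (h := fun _ c => c) hf hg
    (by fun_prop)).of_eq fun a => by cases f a <;> rfl

@[fun_prop]
theorem computable_terms {f : σ → Condition I} (hf : Computable f) :
    Computable fun a => (f a).terms := by
  unfold Condition.terms
  fun_prop

@[fun_prop]
theorem computable_varList {f : σ → Condition I} (hf : Computable f) :
    Computable fun a => (f a).varList := by
  unfold Condition.varList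
  fun_prop

@[fun_prop]
theorem computable_constList {f : σ → Condition I} (hf : Computable f) :
    Computable fun a => (f a).constList := by
  unfold Condition.constList
  fun_prop

@[fun_prop]
theorem computable_signature {f : σ → Condition I} (hf : Computable f) :
    Computable fun a => (f a).signature := by
  unfold Condition.signature
  fun_prop

@[fun_prop]
theorem computable_querySignature {f : σ → Query I k} (hf : Computable f) :
    Computable fun a => (f a).signature := by
  unfold Query.signature
  fun_prop

@[fun_prop]
theorem computable_queryConstList {f : σ → Query I k} (hf : Computable f) :
    Computable fun a => (f a).constList := by
  unfold Query.constList
  fun_prop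

@[fun_prop]
theorem computable_groundAtoms {f : σ → List (ℕ × ℕ)} {g : σ → List I} (hf : Computable f)
    (hg : Computable g) : Computable fun a => groundAtoms (f a) (g a) := by
  unfold groundAtoms
  fun_prop

@[fun_prop]
theorem computable_assign [Nonempty I] {f : σ → Condition I} {g : σ → List I} {h : σ → ℕ}
    (hf : Computable f) (hg : Computable g) (hh : Computable h) :
    Computable fun a => (f a).assign (g a) (h a) := by
  unfold Condition.assign
  fun_prop

variable [LinearOrder I]

@[fun_prop]
theorem computable_conditionRange {f : σ → Condition I} {g : σ → List (ℕ × List I)}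
    (hf : Computable f) (hg : Computable g) : Computable fun a => (f a).range (g a) := by
  unfold Condition.range
  fun_prop

theorem EffectiveOrder.lt_comp (hI : EffectiveOrder I) {f g : σ → I} (hf : Computable f)
    (hg : Computable g) : ComputablePred fun a => f a < g a :=
  hI.lt.comp (hf.pair hg)

theorem EffectiveOrder.comp_holds (hI : EffectiveOrder I) {c : σ → Comp} {f g : σ → I}
    (hc : Computable c) (hf : Computable f) (hg : Computable g) :
    ComputablePred fun a => (c a).Holds (f a) (g a) := by
  have e (r : Comp) : ComputablePred fun a => c a = r := hc.pred_eq (by fun_prop)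
  have lt := hI.lt_comp hf hg
  have gt := hI.lt_comp hg hf
  have eq := hf.pred_eq hg
  -- The comparison symbol is itself input data, so the six cases are combined as implications, each
  -- reduced to `<` or `=` and its negation.
  refine (((e .lt).imp lt).conj <| ((e .le).imp gt.neg).conj <| ((e .eq).imp eq).conj <|
    ((e .ne).imp eq.neg).conj <| ((e .ge).imp lt.neg).conj ((e .gt).imp gt)).of_eq fun a => ?_
  cases c a <;> simp [Comp.Holds]

theorem computablePred_relHolds {f : σ → RelAtom I} {L : σ → List (ℕ × List I)} {g : σ → ℕ → I}
    (hf : Computable f) (hL : Computable L) (hg : Computable fun x : σ × ℕ => g x.1 x.2) :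
    ComputablePred fun a => (f a).Holds (L a).toFinset (g a) := by
  unfold RelAtom.Holds
  simp only [List.mem_toFinset]
  refine ComputablePred.mem_list ?_ hL
  fun_prop

theorem EffectiveOrder.computable_listBetween (hI : EffectiveOrder I) {S : σ → List I}
    {a b : σ → Option I} (hS : Computable S) (ha : Computable a) (hb : Computable b) :
    Computable fun x => listBetween (S x) (a x) (b x) := by
  have l : Computable (Option.toList : Option I → List I) := Primrec.optionToList.to_comp
  refine Computable.list_filter hS (ComputablePred.conj
    (ComputablePred.forall_mem_list (by fun_prop) ?_)
    (ComputablePred.forall_mem_list (by fun_prop) ?_))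
  · exact hI.lt_comp (by fun_prop) (by fun_prop)
  · exact hI.lt_comp (by fun_prop) (by fun_prop)

theorem EffectiveOrder.condition_holds (hI : EffectiveOrder I) {f : σ → Condition I}
    {L : σ → List (ℕ × List I)} {g : σ → ℕ → I} (hf : Computable f) (hL : Computable L)
    (hg : Computable fun x : σ × ℕ => g x.1 x.2) :
    ComputablePred fun a => (f a).Holds (L a).toFinset (g a) := by
  unfold Condition.Holds
  refine (ComputablePred.forall_mem_list (by fun_prop) ?_).conj
    ((ComputablePred.forall_mem_list (by fun_prop) ?_).conj
      (ComputablePred.forall_mem_list (by fun_prop) ?_))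
  · exact computablePred_relHolds (by fun_prop) (by fun_prop) (by fun_prop)
  · exact (computablePred_relHolds (by fun_prop) (by fun_prop) (by fun_prop)).neg
  · exact hI.comp_holds (by fun_prop) (by fun_prop) (by fun_prop)

/-- All quantifiers in `Adequate` run over finite lists except the one over finite sets `s`, and
that one is decided by `EffectiveOrder.between`. -/
theorem EffectiveOrder.computablePred_adequate (hI : EffectiveOrder I) {N : σ → ℕ}
    {C S : σ → List I} (hN : Computable N) (hC : Computable C) (hS : Computable S) :
    ComputablePred fun a => Adequate (N a) (C a) (S a) := by
  refine (ComputablePred.forall_mem_list hC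
    (ComputablePred.mem_list (by fun_prop) (by fun_prop))).conj ?_
  refine ComputablePred.forall_mem_list (by fun_prop)
    (ComputablePred.forall_mem_list (by fun_prop) (ComputablePred.forall_mem_list (by fun_prop) ?_))
  have h : Computable fun x : ((σ × Option I) × Option I) × ℕ =>
      listBetween (S x.1.1.1) x.1.1.2 x.1.2 :=
    hI.computable_listBetween (by fun_prop) (by fun_prop) (by fun_prop)
  exact (hI.between.comp
    (f := fun x : ((σ × Option I) × Option I) × ℕ => (x.2, x.1.1.2, x.1.2))
    (by fun_prop)).imp (ComputablePred.nat_le (by fun_prop) (by fun_prop))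

variable [Nonempty I]

theorem EffectiveOrder.computable_solutions (hI : EffectiveOrder I) {A : σ → Condition I}
    {L : σ → List (ℕ × List I)} (hA : Computable A) (hL : Computable L) :
    Computable fun x => (A x).solutions (L x) := by
  classical
  unfold Condition.solutions
  exact Computable.list_filter
    (p := fun x w => (A x).Holds (L x).toFinset ((A x).assign w)) (by fun_prop)
    (hI.condition_holds (by fun_prop) (by fun_prop) (by fun_prop))

theorem EffectiveOrder.computable_answers (hI : EffectiveOrder I) {q : σ → Query I k}
    {L : σ → List (ℕ × List I)} (hq : Computable q) (hL : Computable L) :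
    Computable fun x => (q x).answers (L x) := by
  unfold Query.answers
  have h1 : Computable fun x : σ × Condition I => x.2.solutions (L x.1) :=
    hI.computable_solutions (by fun_prop) (by fun_prop)
  have h2 : Computable fun x : (σ × Condition I) × List I =>
      fun j => x.1.2.assign x.2 ((q x.1.1).agg j) := Computable.fin_arrow fun j => by
    have h : Computable fun x : (σ × Condition I) × List I => (q x.1.1).agg j :=
      Computable.fin_app.comp (by fun_prop) (Computable.const j)
    fun_prop
  refine Computable.fun_flatMap (by fun_prop) (Computable.fun_map h1 (Computable.pair ?_ h2))
  fun_prop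

theorem EffectiveOrder.computable_bagList (hI : EffectiveOrder I) {q : σ → Query I k}
    {L : σ → List (ℕ × List I)} {d : σ → List I} (hq : Computable q) (hL : Computable L)
    (hd : Computable d) : Computable fun a => (q a).bagList (L a) (d a) := by
  unfold Query.bagList
  exact Computable.fun_map (Computable.list_filter
    (p := fun a (r : List I × (Fin k → I)) => r.1 = d a) (hI.computable_answers hq hL)
    (Computable.pred_eq (by fun_prop) (by fun_prop))) (by fun_prop)

theorem EffectiveOrder.computablePred_agreeOn (hI : EffectiveOrder I) {V : Type*}
    {α : Multiset (Fin k → I) → V} (hα : EffectiveAggregation α) {q q' : σ → Query I k}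
    {L : σ → List (ℕ × List I)} (hq : Computable q) (hq' : Computable q') (hL : Computable L) :
    ComputablePred fun a => AgreeOn α (q a) (q' a) (L a) := by
  unfold AgreeOn
  have b1 : Computable fun x : σ × List I × (Fin k → I) => (q x.1).bagList (L x.1) x.2.1 :=
    hI.computable_bagList (by fun_prop) (by fun_prop) (by fun_prop)
  have b2 : Computable fun x : σ × List I × (Fin k → I) => (q' x.1).bagList (L x.1) x.2.1 :=
    hI.computable_bagList (by fun_prop) (by fun_prop) (by fun_prop)
  refine ComputablePred.forall_mem_list (Computable.fun_append
    (hI.computable_answers hq hL) (hI.computable_answers hq' hL)) ?_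
  exact (b1.pred_eq (.const [])).neg.conj ((b2.pred_eq (.const [])).neg.conj
    (hα.comp (b1.pair b2)))

theorem EffectiveOrder.computablePred_equivalentWithin (hI : EffectiveOrder I) {V : Type*}
    {α : Multiset (Fin k → I) → V} (hα : EffectiveAggregation α) {N : σ → ℕ}
    {q q' : σ → Query I k} {S : σ → List I} (hN : Computable N) (hq : Computable q)
    (hq' : Computable q') (hS : Computable S) :
    ComputablePred fun a => EquivalentWithin α (N a) (q a) (q' a) (S a) := by
  refine ComputablePred.forall_mem_list (by fun_prop)
    (ComputablePred.forall_mem_list (by fun_prop) ?_)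
  exact hI.computablePred_agreeOn hα (by fun_prop) (by fun_prop) (by fun_prop)

end Computability

end AggQuery

namespace AggQuery

/-! ### Agreement of list evaluation with the semantics -/

section Correctness

variable {I : Type*} {k : ℕ}

theorem Condition.mem_varList {A : Condition I} {v : ℕ} : v ∈ A.varList ↔ v ∈ A.vars := by
  simp only [Condition.varList, Condition.vars, List.mem_dedup, List.mem_toFinset,
    List.mem_flatMap]
  refine exists_congr fun t => and_congr_right fun _ => ?_
  cases t <;> simp [Term.varList]

theorem Condition.mem_constList {A : Condition I} {c : I} :
    c ∈ A.constList ↔ .const c ∈ A.terms := by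
  simp only [Condition.constList, List.mem_flatMap]
  constructor
  · rintro ⟨_ | _, h, h'⟩ <;> simp_all [Term.constList]
  · exact fun h => ⟨_, h, by simp [Term.constList]⟩

theorem Condition.mem_consts [DecidableEq I] {A : Condition I} {c : I} :
    c ∈ A.consts ↔ c ∈ A.constList := by
  simp only [Condition.constList, Condition.consts, List.mem_toFinset, List.mem_flatMap]
  refine exists_congr fun t => and_congr_right fun _ => ?_
  cases t <;> simp [Term.constList]

theorem Condition.assign_of_notMem [Nonempty I] {A : Condition I} {w : List I}
    (hw : w.length = A.varList.length) {v : ℕ} (hv : v ∉ A.vars) :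
    A.assign w v = Classical.arbitrary I := by
  rw [Condition.assign, List.getD_eq_default]
  rw [List.idxOf_eq_length (by rwa [Condition.mem_varList]), hw]

theorem Condition.extend_assign [Nonempty I] {A : Condition I} {w : List I}
    (hw : w.length = A.varList.length) :
    A.extend (fun v => A.assign w v) = A.assign w := by
  funext v
  by_cases hv : v ∈ A.vars
  · simp [Condition.extend, hv]
  · simp [Condition.extend, hv, Condition.assign_of_notMem hw hv]

theorem Condition.assign_map [Nonempty I] (A : Condition I) (g : ℕ → I) {v : ℕ}
    (hv : v ∈ A.vars) : A.assign (A.varList.map g) v = g v := by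
  have h := List.idxOf_lt_length_of_mem (Condition.mem_varList.2 hv)
  rw [Condition.assign, List.getD_eq_getElem _ _ (by simpa using h)]
  simp

theorem Condition.assign_injOn [Nonempty I] {A : Condition I} {w w' : List I}
    (hw : w.length = A.varList.length) (hw' : w'.length = A.varList.length)
    (h : ∀ v ∈ A.vars, A.assign w v = A.assign w' v) : w = w' := by
  refine List.ext_getElem (hw.trans hw'.symm) fun i h1 h2 => ?_
  have hi : i < A.varList.length := hw ▸ h1
  have key := h A.varList[i] (Condition.mem_varList.1 (List.getElem_mem hi))
  have hn : A.varList.Nodup := List.nodup_dedup _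
  rwa [Condition.assign, Condition.assign, hn.idxOf_getElem i hi, List.getD_eq_getElem _ _ h1,
    List.getD_eq_getElem _ _ h2] at key

variable [LinearOrder I]

theorem Condition.mem_range {A : Condition I} {L : List (ℕ × List I)} {x : I} :
    x ∈ A.range L ↔ x ∈ Database.carrier L.toFinset ∪ A.consts := by
  simp [Condition.range, Database.carrier, Condition.mem_consts]

variable [Nonempty I]

/-- Words of values and assignments correspond bijectively because `varList` lists each variable
once. Stated for multisets, so that the multiplicities in the bags are preserved. -/
theorem Condition.assignments_val (A : Condition I) (L : List (ℕ × List I)) :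
    (A.assignments L.toFinset).val =
      ((A.solutions L).map fun w (v : A.vars) => A.assign w v : Multiset (A.vars → I)) := by
  classical
  have hlen : ∀ w ∈ A.solutions L, w.length = A.varList.length := fun w hw =>
    (List.mem_words.1 (List.mem_filter.1 hw).1).1
  refine (Multiset.Nodup.ext (Finset.nodup _) ?_).2 fun γ => ?_
  · refine Multiset.coe_nodup.2 (List.Nodup.map_on (fun w hw w' hw' h => ?_)
      ((List.nodup_words (List.nodup_dedup _) _).filter _))
    exact Condition.assign_injOn (hlen w hw) (hlen w' hw') fun v hv => congrFun h ⟨v, hv⟩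
  · simp only [Finset.mem_val, Condition.assignments, Finset.mem_filter, Fintype.mem_piFinset,
      Multiset.mem_coe, List.mem_map]
    constructor
    · rintro ⟨h1, h2⟩
      have he : (fun v : A.vars => A.assign (A.varList.map (A.extend γ)) v) = γ := by
        funext v
        rw [Condition.assign_map A _ v.2]
        simp [Condition.extend]
      refine ⟨A.varList.map (A.extend γ), List.mem_filter.2 ⟨List.mem_words.2 ⟨by simp, ?_⟩, ?_⟩,
        he⟩
      · simp only [List.mem_map]
        rintro _ ⟨v, hv, rfl⟩
        rw [Condition.mem_varList] at hv
        simpa [Condition.extend, hv, Condition.mem_range] using h1 ⟨v, hv⟩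
      · rw [← Condition.extend_assign (by simp), he]
        simpa using h2
    · rintro ⟨w, hw, rfl⟩
      have hw' := List.mem_filter.1 hw
      refine ⟨fun v => Condition.mem_range.1 ?_, ?_⟩
      · have hi : A.varList.idxOf v.1 < w.length := by
          rw [hlen w hw]
          exact List.idxOf_lt_length_of_mem (Condition.mem_varList.2 v.2)
        change A.assign w v.1 ∈ _
        rw [Condition.assign, List.getD_eq_getElem _ _ hi]
        exact (List.mem_words.1 hw'.1).2 _ (List.getElem_mem hi)
      · rw [Condition.extend_assign (hlen w hw)]
        simpa using hw'.2

theorem Query.bag_eq_bagList (q : Query I k) (L : List (ℕ × List I)) (d : List I) :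
    q.bag L.toFinset d = (q.bagList L d : Multiset (Fin k → I)) := by
  classical
  have key : ∀ A : Condition I,
      (((A.assignments L.toFinset).filter fun γ => q.grouping.map (A.extend γ) = d).val.map
        fun γ j => A.extend γ (q.agg j)) =
      ((((A.solutions L).map fun w =>
        (q.grouping.map (A.assign w), fun j => A.assign w (q.agg j))).filter
          fun r => r.1 = d).map fun r => r.2 : Multiset (Fin k → I)) := by
    intro A
    have hlen : ∀ w ∈ A.solutions L, w.length = A.varList.length := fun w hw =>
      (List.mem_words.1 (List.mem_filter.1 hw).1).1
    rw [Finset.filter_val, Condition.assignments_val]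
    simp only [Multiset.filter_coe, Multiset.map_coe]
    congr 1
    generalize A.solutions L = S at hlen
    induction S with
    | nil => simp
    | cons w l ih =>
      have hw := Condition.extend_assign (hlen w (by simp))
      have ih' := ih fun w' hw' => hlen w' (by simp [hw'])
      simp only [List.map_cons, List.filter_cons, hw]
      split_ifs <;> simp [ih', hw]
  unfold Query.bag Query.bagList Query.answers
  induction q.disjuncts with
  | nil => simp
  | cons A l ih =>
    simp only [List.map_cons, List.sum_cons, List.flatMap_cons, List.filter_append,
      List.map_append, ← Multiset.coe_add, ih, key A]

/-- A result holds at most one pair per group, so two results coincide when the same groups are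
nonempty and their aggregates agree. -/
theorem result_eq_iff {V : Type*} {α : Multiset (Fin k → I) → V} {q q' : Query I k}
    {D : Database I} :
    q.result α D = q'.result α D ↔ ∀ d, q.bag D d ≠ 0 ∨ q'.bag D d ≠ 0 →
      q.bag D d ≠ 0 ∧ q'.bag D d ≠ 0 ∧ α (q.bag D d) = α (q'.bag D d) := by
  simp only [Query.result, Set.ext_iff, Set.mem_ofPred_eq, Prod.forall]
  constructor
  · rintro h d (h1 | h1)
    · obtain ⟨h2, h3⟩ := (h d _).1 ⟨h1, rfl⟩
      exact ⟨h1, h2, h3⟩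
    · obtain ⟨h2, h3⟩ := (h d _).2 ⟨h1, rfl⟩
      exact ⟨h2, h1, h3.symm⟩
  · intro h d v
    constructor
    · rintro ⟨h1, rfl⟩
      exact (h d (.inl h1)).2
    · rintro ⟨h1, rfl⟩
      obtain ⟨h2, -, h3⟩ := h d (.inr h1)
      exact ⟨h2, h3.symm⟩

/-- The groups with a nonempty bag are exactly the first components of the answers, so checking
these finitely many groups is enough. -/
theorem agreeOn_iff {V : Type*} {α : Multiset (Fin k → I) → V} {q q' : Query I k}
    {L : List (ℕ × List I)} :
    AgreeOn α q q' L ↔ q.result α L.toFinset = q'.result α L.toFinset := by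
  have hne (q : Query I k) (d : List I) : q.bagList L d ≠ [] ↔ ∃ r ∈ q.answers L, r.1 = d := by
    simp [Query.bagList]
  simp only [result_eq_iff, Query.bag_eq_bagList, ne_eq, Multiset.coe_eq_zero, AgreeOn]
  simp only [← ne_eq]
  constructor
  · intro h d hd
    rw [hne, hne] at hd
    rcases hd with ⟨r, hr, rfl⟩ | ⟨r, hr, rfl⟩
    · exact h r (List.mem_append_left _ hr)
    · exact h r (List.mem_append_right _ hr)
  · intro h r hr
    refine h r.1 ((List.mem_append.1 hr).imp (fun h' => ?_) fun h' => ?_)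
    · exact (hne q r.1).2 ⟨r, h', rfl⟩
    · exact (hne q' r.1).2 ⟨r, h', rfl⟩

end Correctness

end AggQuery

namespace AggQuery

/-! ### Transfer of query results along embeddings that fix the constants -/

section Transfer

variable {I : Type*} {k : ℕ}

theorem Term.eval_comp {φ : I → I} {t : Term I} (γ : ℕ → I) (h : ∀ c, t = .const c → φ c = c) :
    t.eval (φ ∘ γ) = φ (t.eval γ) := by
  cases t with
  | var v => rfl
  | const c => exact (h c rfl).symm

theorem Condition.extend_comp [Nonempty I] {φ : I → I} (A : Condition I)
    (h : φ (Classical.arbitrary I) = Classical.arbitrary I) (γ : A.vars → I) :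
    A.extend (φ ∘ γ) = φ ∘ A.extend γ := by
  funext v
  by_cases hv : v ∈ A.vars <;> simp [Condition.extend, hv, h]

theorem Condition.constList_subset {q : Query I k} {A : Condition I} (hA : A ∈ q.disjuncts) :
    A.constList ⊆ q.constList :=
  fun _ hc => List.mem_flatMap.2 ⟨A, hA, hc⟩

variable [LinearOrder I]

/-- The image of a database under a map of constants. -/
def Database.map (φ : I → I) (D : Database I) : Database I :=
  D.image fun a => (a.1, a.2.map φ)

theorem Database.mem_carrier {D : Database I} {x : I} :
    x ∈ D.carrier ↔ ∃ a ∈ D, x ∈ a.2 := by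
  simp [Database.carrier]

theorem Database.carrier_map (φ : I → I) (D : Database I) :
    (D.map φ).carrier = D.carrier.image φ := by
  ext x
  simp only [Database.mem_carrier, Database.map, Finset.mem_image, exists_exists_and_eq_and,
    List.mem_map]
  tauto

/-- `φ` is a strictly monotonic map on `U` that fixes the constants in `C`. -/
structure FixingEmbedding (φ : I → I) (U : Set I) (C : List I) : Prop where
  strictMonoOn : StrictMonoOn φ U
  mem : ∀ c ∈ C, c ∈ U
  fix : ∀ c ∈ C, φ c = c

variable {φ : I → I} {U : Set I} {C : List I}

theorem FixingEmbedding.mono (h : FixingEmbedding φ U C) {C' : List I} (hC : C' ⊆ C) :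
    FixingEmbedding φ U C' :=
  ⟨h.1, fun c hc => h.2 c (hC hc), fun c hc => h.3 c (hC hc)⟩

theorem FixingEmbedding.list_map_inj (h : FixingEmbedding φ U C) {l l' : List I}
    (hl : ∀ x ∈ l, x ∈ U) (hl' : ∀ x ∈ l', x ∈ U) (e : l.map φ = l'.map φ) : l = l' := by
  refine List.ext_getElem (by simpa using congrArg List.length e) fun i h1 h2 => ?_
  have key := List.getElem_of_eq e (i := i) (by simpa using h1)
  rw [List.getElem_map, List.getElem_map] at key
  exact h.strictMonoOn.injOn (hl _ (List.getElem_mem h1)) (hl' _ (List.getElem_mem h2)) key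

theorem FixingEmbedding.mem_map_iff (h : FixingEmbedding φ U C) {D : Database I}
    (hD : ∀ x ∈ D.carrier, x ∈ U) {p : ℕ} {l : List I} (hl : ∀ x ∈ l, x ∈ U) :
    (p, l.map φ) ∈ D.map φ ↔ (p, l) ∈ D := by
  simp only [Database.map, Finset.mem_image, Prod.mk.injEq]
  constructor
  · rintro ⟨⟨p', l'⟩, hmem, rfl, e⟩
    have hl' : ∀ x ∈ l', x ∈ U := fun x hx => hD x (Database.mem_carrier.2 ⟨_, hmem, hx⟩)
    have : l' = l := h.list_map_inj hl' hl e
    rwa [← this]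
  · exact fun hm => ⟨_, hm, rfl, rfl⟩

theorem FixingEmbedding.comp_holds (h : FixingEmbedding φ U C) (c : Comp) {a b : I} (ha : a ∈ U)
    (hb : b ∈ U) : c.Holds (φ a) (φ b) ↔ c.Holds a b := by
  cases c <;> simp only [Comp.Holds, ge_iff_le, gt_iff_lt, ne_eq, h.strictMonoOn.lt_iff_lt ha hb,
    h.strictMonoOn.lt_iff_lt hb ha, h.strictMonoOn.le_iff_le ha hb,
    h.strictMonoOn.le_iff_le hb ha, h.strictMonoOn.injOn.eq_iff ha hb]

/-- Evaluation of terms commutes with `φ` since the constants are fixed. Relational atoms, also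
negated ones, are then preserved and reflected by injectivity on `U`, comparisons by strict
monotonicity. -/
theorem FixingEmbedding.condition_holds {A : Condition I} (h : FixingEmbedding φ U A.constList)
    {D : Database I} (hD : ∀ x ∈ D.carrier, x ∈ U) {γ : ℕ → I} (hγ : ∀ v, γ v ∈ U) :
    A.Holds (D.map φ) (φ ∘ γ) ↔ A.Holds D γ := by
  have hev : ∀ t ∈ A.terms, t.eval (φ ∘ γ) = φ (t.eval γ) ∧ t.eval γ ∈ U := by
    intro t ht
    refine ⟨Term.eval_comp γ ?_, ?_⟩
    · rintro c rfl
      exact h.fix c (Condition.mem_constList.2 ht)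
    · cases t with
      | var v => exact hγ v
      | const c => exact h.mem c (Condition.mem_constList.2 ht)
  have hrel : ∀ a : RelAtom I, (∀ t ∈ a.args, t ∈ A.terms) →
      (a.Holds (D.map φ) (φ ∘ γ) ↔ a.Holds D γ) := by
    intro a ha
    have e : a.args.map (Term.eval (φ ∘ γ)) = (a.args.map (Term.eval γ)).map φ := by
      rw [List.map_map]
      exact List.map_congr_left fun t ht => (hev t (ha t ht)).1
    rw [RelAtom.Holds, RelAtom.Holds, e]
    refine h.mem_map_iff hD fun x hx => ?_
    obtain ⟨t, ht, rfl⟩ := List.mem_map.1 hx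
    exact (hev t (ha t ht)).2
  unfold Condition.Holds
  refine and_congr (forall₂_congr fun a ha => hrel a fun t ht => ?_)
    (and_congr (forall₂_congr fun a ha => not_congr (hrel a fun t ht => ?_))
      (forall₂_congr fun c hc => ?_))
  · simp only [Condition.terms, List.mem_append, List.mem_flatMap]
    exact .inl (.inl ⟨a, ha, ht⟩)
  · simp only [Condition.terms, List.mem_append, List.mem_flatMap]
    exact .inl (.inr ⟨a, ha, ht⟩)
  · have hl : c.lhs ∈ A.terms := by
      simp only [Condition.terms, List.mem_append, List.mem_flatMap]
      exact .inr ⟨c, hc, by simp⟩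
    have hr : c.rhs ∈ A.terms := by
      simp only [Condition.terms, List.mem_append, List.mem_flatMap]
      exact .inr ⟨c, hc, by simp⟩
    rw [OrdAtom.Holds, OrdAtom.Holds, (hev _ hl).1, (hev _ hr).1]
    exact h.comp_holds _ (hev _ hl).2 (hev _ hr).2

/-- Restates shiftability for a map on all of `I` that is monotonic only on `U`; the bags are lifted
to the subtype `U`. -/
theorem Shiftable.eq_iff {V : Type*} {α : Multiset (Fin k → I) → V} (hα : Shiftable α)
    (hφ : StrictMonoOn φ U) {B B' : Multiset (Fin k → I)} (hB : ∀ t ∈ B, ∀ j, t j ∈ U)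
    (hB' : ∀ t ∈ B', ∀ j, t j ∈ U) :
    α B = α B' ↔ α (B.map fun t => φ ∘ t) = α (B'.map fun t => φ ∘ t) := by
  have lift : ∀ B : Multiset (Fin k → I), (∀ t ∈ B, ∀ j, t j ∈ U) →
      ∃ B₀ : Multiset (Fin k → U), B = B₀.map fun t j => (t j : I) := by
    intro B hB
    refine ⟨B.attach.map fun t j => ⟨t.1 j, hB t.1 t.2 j⟩, ?_⟩
    rw [Multiset.map_map]
    exact (Multiset.attach_map_val B).symm
  obtain ⟨B₀, rfl⟩ := lift B hB
  obtain ⟨B₁, rfl⟩ := lift B' hB'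
  have := hα U Set.univ (fun x => ⟨φ x, trivial⟩) (fun x y hxy => hφ x.2 y.2 hxy) B₀ B₁
  simp only [Multiset.map_map]
  exact this

variable [Nonempty I]

/-- Variables outside the condition receive the default value `Classical.arbitrary I`; this is why
that element is treated as a further constant. -/
theorem Condition.extend_mem {A : Condition I} {D : Database I} (hD : ∀ x ∈ D.carrier, x ∈ U)
    (h : FixingEmbedding φ U (Classical.arbitrary I :: A.constList)) {γ : A.vars → I}
    (hγ : ∀ v, γ v ∈ D.carrier ∪ A.consts) (v : ℕ) : A.extend γ v ∈ U := by
  by_cases hv : v ∈ A.vars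
  · have := hγ ⟨v, hv⟩
    simp only [Condition.extend, hv, dite_true]
    rcases Finset.mem_union.1 this with h' | h'
    · exact hD _ h'
    · exact h.mem _ (List.mem_cons_of_mem _ (Condition.mem_consts.1 h'))
  · simpa [Condition.extend, hv] using h.mem _ List.mem_cons_self

theorem Condition.assignments_mem {A : Condition I} {D : Database I} {γ : A.vars → I}
    (hγ : γ ∈ A.assignments D) (v : A.vars) : γ v ∈ D.carrier ∪ A.consts := by
  classical
  unfold Condition.assignments at hγ
  exact Fintype.mem_piFinset.1 (Finset.mem_filter.1 hγ).1 v

/-- Composition with `φ` is injective on the assignments with values in `U`. It is onto because the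
range of values over `D.map φ` is the `φ`-image of the range over `D`, the constants being fixed. -/
theorem FixingEmbedding.assignments_map {A : Condition I} {D : Database I}
    (h : FixingEmbedding φ U (Classical.arbitrary I :: A.constList))
    (hD : ∀ x ∈ D.carrier, x ∈ U) :
    (A.assignments (D.map φ)).val = (A.assignments D).val.map fun γ => φ ∘ γ := by
  classical
  have hU : ∀ x ∈ D.carrier ∪ A.consts, x ∈ U := by
    intro x hx
    rcases Finset.mem_union.1 hx with h' | h'
    · exact hD _ h'
    · exact h.mem _ (List.mem_cons_of_mem _ (Condition.mem_consts.1 h'))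
  have harb := h.fix _ List.mem_cons_self
  have hA := h.mono (List.subset_cons_self (Classical.arbitrary I) A.constList)
  have himg : (D.map φ).carrier ∪ A.consts = (D.carrier ∪ A.consts).image φ := by
    rw [Finset.image_union, Database.carrier_map]
    congr 1
    ext c
    simp only [Finset.mem_image, Condition.mem_consts]
    constructor
    · exact fun hc => ⟨c, hc, hA.fix c hc⟩
    · rintro ⟨c, hc, rfl⟩
      rwa [hA.fix c hc]
  refine (Multiset.Nodup.ext (Finset.nodup _) ?_).2 fun γ => ?_
  · refine Multiset.Nodup.map_on (fun γ hγ γ' hγ' e => ?_) (Finset.nodup _)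
    funext v
    exact h.strictMonoOn.injOn (hU _ (Condition.assignments_mem hγ v))
      (hU _ (Condition.assignments_mem hγ' v)) (congrFun e v)
  · have hiff : ∀ γ : A.vars → I, (∀ v, γ v ∈ D.carrier ∪ A.consts) →
        (A.Holds (D.map φ) (A.extend (φ ∘ γ)) ↔ A.Holds D (A.extend γ)) := by
      intro γ hγ
      rw [Condition.extend_comp A harb]
      exact hA.condition_holds hD (Condition.extend_mem hD h hγ)
    simp only [Condition.assignments, Finset.mem_val, Multiset.mem_map, Finset.mem_filter,
      Fintype.mem_piFinset, himg, Finset.mem_image]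
    constructor
    · rintro ⟨h1, h2⟩
      choose γ' h3 h4 using h1
      obtain rfl : φ ∘ γ' = γ := funext h4
      exact ⟨γ', ⟨h3, (hiff _ h3).1 h2⟩, rfl⟩
    · rintro ⟨γ', ⟨h3, h4⟩, rfl⟩
      exact ⟨fun v => ⟨γ' v, h3 v, rfl⟩, (hiff _ h3).2 h4⟩

theorem Query.mem_bag {q : Query I k} {D : Database I} {d : List I} {t : Fin k → I} :
    t ∈ q.bag D d ↔ ∃ A ∈ q.disjuncts, ∃ γ ∈ A.assignments D,
      q.grouping.map (A.extend γ) = d ∧ (fun j => A.extend γ (q.agg j)) = t := by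
  unfold Query.bag
  induction q.disjuncts with
  | nil => simp
  | cons A l ih =>
    rw [List.map_cons, List.sum_cons, Multiset.mem_add, ih]
    simp [and_assoc]

theorem FixingEmbedding.mem_of_mem_bag {q : Query I k} {D : Database I} {d : List I}
    (h : FixingEmbedding φ U (Classical.arbitrary I :: q.constList))
    (hD : ∀ x ∈ D.carrier, x ∈ U) {t : Fin k → I} (ht : t ∈ q.bag D d) :
    (∀ x ∈ d, x ∈ U) ∧ ∀ j, t j ∈ U := by
  obtain ⟨A, hA, γ, hγ, rfl, rfl⟩ := Query.mem_bag.1 ht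
  have key := Condition.extend_mem hD
    (h.mono (List.cons_subset_cons _ (Condition.constList_subset hA)))
    (Condition.assignments_mem hγ)
  refine ⟨fun x hx => ?_, fun j => key _⟩
  obtain ⟨v, -, rfl⟩ := List.mem_map.1 hx
  exact key v

theorem FixingEmbedding.bag_map {q : Query I k} {D : Database I} {d : List I}
    (h : FixingEmbedding φ U (Classical.arbitrary I :: q.constList))
    (hD : ∀ x ∈ D.carrier, x ∈ U) (hd : ∀ x ∈ d, x ∈ U) :
    q.bag (D.map φ) (d.map φ) = (q.bag D d).map fun t => φ ∘ t := by
  have harb := h.fix _ List.mem_cons_self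
  unfold Query.bag
  rw [← Multiset.coe_mapAddMonoidHom, map_list_sum, List.map_map]
  congr 1
  refine List.map_congr_left fun A hA => ?_
  have h' := h.mono (List.cons_subset_cons (Classical.arbitrary I) (Condition.constList_subset hA))
  simp only [Function.comp_apply, Multiset.coe_mapAddMonoidHom, Finset.filter_val,
    h'.assignments_map hD, Multiset.filter_map, Multiset.map_map]
  -- Since `φ` is injective on `U`, which contains both lists, an assignment is in the group `d.map
  -- φ` after applying `φ` exactly if it was in the group `d` before.
  have hfil : (A.assignments D).val.filter
      (fun γ => q.grouping.map (A.extend (φ ∘ γ)) = d.map φ) =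
      (A.assignments D).val.filter fun γ => q.grouping.map (A.extend γ) = d := by
    refine Multiset.filter_congr fun γ hγ => ?_
    have key := Condition.extend_mem hD h' (Condition.assignments_mem hγ)
    rw [Condition.extend_comp A harb, ← List.map_map]
    refine ⟨h.list_map_inj (fun x hx => ?_) hd, fun e => e ▸ rfl⟩
    obtain ⟨v, -, rfl⟩ := List.mem_map.1 hx
    exact key v
  rw [hfil]
  refine Multiset.map_congr rfl fun γ _ => ?_
  funext j
  simp [Condition.extend_comp A harb]

theorem FixingEmbedding.result_eq {V : Type*} {α : Multiset (Fin k → I) → V} (hα : Shiftable α)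
    {q q' : Query I k} {D : Database I}
    (h : FixingEmbedding φ U (Classical.arbitrary I :: (q.constList ++ q'.constList)))
    (hD : ∀ x ∈ D.carrier, x ∈ U)
    (he : q.result α (D.map φ) = q'.result α (D.map φ)) : q.result α D = q'.result α D := by
  rw [result_eq_iff] at he ⊢
  have h1 := h.mono (List.cons_subset_cons _ (List.subset_append_left q.constList q'.constList))
  have h2 := h.mono (List.cons_subset_cons _ (List.subset_append_right q.constList q'.constList))
  intro d hd
  -- A group with a nonempty bag consists of values of assignments, hence of elements of `U`.
  have hdU : ∀ x ∈ d, x ∈ U := by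
    rcases hd with hd | hd
    · obtain ⟨t, ht⟩ := Multiset.exists_mem_of_ne_zero hd
      exact (h1.mem_of_mem_bag hD ht).1
    · obtain ⟨t, ht⟩ := Multiset.exists_mem_of_ne_zero hd
      exact (h2.mem_of_mem_bag hD ht).1
  have := he (d.map φ)
  rw [h1.bag_map hD hdU, h2.bag_map hD hdU] at this
  simp only [ne_eq, Multiset.map_eq_zero] at this
  rw [hα.eq_iff h.strictMonoOn (fun t ht => (h1.mem_of_mem_bag hD ht).2)
    (fun t ht => (h2.mem_of_mem_bag hD ht).2)]
  exact this hd

end Transfer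

end AggQuery

namespace AggQuery

/-! ### Embedding small sets into adequate lists -/

section Gaps

variable {I : Type*} [LinearOrder I]

/-- `s` is on the same side as `x` of all constants in `C` other than `x`. -/
def SameGap (C : List I) (x s : I) : Prop := ∀ c ∈ C, (c < x → c < s) ∧ (x < c → s < c)

/-- The bound is the greatest constant below `x`, or missing if there is none. With its order dual
it presents the gap of `x` as an interval of the kind that `Adequate` speaks about. -/
theorem exists_lower_bound (C : List I) (x : I) :
    ∃ a ∈ none :: C.map some, ∀ s, (∀ c, a = some c → c < s) ↔ ∀ c ∈ C, c < x → c < s := by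
  by_cases h : ∃ c ∈ C, c < x
  · obtain ⟨c₀, h₀, h₁⟩ := h
    obtain ⟨m, hm, hmax⟩ := Finset.exists_max_image (C.toFinset.filter (· < x)) id
      ⟨c₀, by simp [h₀, h₁]⟩
    simp only [Finset.mem_filter, List.mem_toFinset, id, and_imp] at hm hmax
    refine ⟨some m, by simp [hm.1], fun s => ⟨fun hs c hc hcx => ?_, ?_⟩⟩
    · exact (hmax c hc hcx).trans_lt (hs m rfl)
    · rintro hs _ ⟨⟩
      exact hs m hm.1 hm.2
  · push Not at h
    exact ⟨none, by simp, fun s => ⟨fun _ c hc hcx => absurd hcx (h c hc).not_gt, by simp⟩⟩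

theorem exists_upper_bound (C : List I) (x : I) :
    ∃ b ∈ none :: C.map some, ∀ s, (∀ c, b = some c → s < c) ↔ ∀ c ∈ C, x < c → s < c :=
  exists_lower_bound (I := Iᵒᵈ) C x

/-- The part of `E` in the gap of `x` itself witnesses that this interval has that many elements, at
most `N`; adequacy then provides as many in `S`. -/
theorem Adequate.card_le {N : ℕ} {C S : List I} (h : Adequate N C S) {E : Finset I}
    (hE : E.card ≤ N) (x : I) [DecidablePred (SameGap C x)] :
    (E.filter (SameGap C x)).card ≤ (S.toFinset.filter (SameGap C x)).card := by
  obtain ⟨a, ha, ha'⟩ := exists_lower_bound C x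
  obtain ⟨b, hb, hb'⟩ := exists_upper_bound C x
  have hab : ∀ s, SameGap C x s ↔ (∀ c, a = some c → c < s) ∧ ∀ c, b = some c → s < c := by
    intro s
    rw [ha', hb', ← forall₂_and]
    rfl
  have key := h.2 a ha b hb (E.filter (SameGap C x)).card
    (List.mem_range.2 (Nat.lt_succ_of_le ((Finset.card_filter_le _ _).trans hE)))
    ⟨_, rfl, fun s hs => (hab s).1 (Finset.mem_filter.1 hs).2⟩
  rw [← List.card_toFinset] at key
  refine key.trans (Finset.card_le_card fun s hs => ?_)
  simpa [listBetween, hab] using hs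

open Classical in
/-- The element with index `n` of `s`. -/
noncomputable def nthElement (s : Finset I) (n : ℕ) (x : I) : I :=
  if h : n < s.card then s.orderEmbOfFin rfl ⟨n, h⟩ else x

theorem nthElement_mem {s : Finset I} {n : ℕ} (h : n < s.card) (x : I) :
    nthElement s n x ∈ s := by
  rw [nthElement, dif_pos h]
  exact Finset.orderEmbOfFin_mem _ _ _

theorem nthElement_lt {s : Finset I} {n m : ℕ} (hnm : n < m) (h : m < s.card) (x y : I) :
    nthElement s n x < nthElement s m y := by
  rw [nthElement, nthElement, dif_pos h, dif_pos (hnm.trans h)]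
  exact (s.orderEmbOfFin rfl).strictMono hnm

/-- Constants stay in place. Any other `x` in `E` goes to the element of `S` in its gap whose index
is the number of smaller elements of `E` in that gap. -/
theorem Adequate.exists_fixingEmbedding {N : ℕ} {C S : List I} (h : Adequate N C S)
    {E : Finset I} (hE : E.card ≤ N) :
    ∃ φ : I → I, FixingEmbedding φ {x | x ∈ E ∨ x ∈ C} C ∧ ∀ x ∈ E, φ x ∈ S := by
  classical
  let gap (T : Finset I) (x : I) : Finset I := T.filter (SameGap C x)
  let rank (x : I) : ℕ := ((gap E x).filter (· < x)).card
  let φ (x : I) : I := if x ∈ C then x else nthElement (gap S.toFinset x) (rank x) x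
  have hfix : ∀ c ∈ C, φ c = c := fun c hc => by simp [φ, hc]
  -- The rank counts a proper subset of the gap of `x` in `E`, since `x` itself is not counted, and
  -- `S` has at least as many elements in this gap.
  have hrank : ∀ x ∈ E, rank x < (gap S.toFinset x).card := by
    intro x hx
    refine (Finset.card_lt_card ?_).trans_le (h.card_le hE x)
    refine Finset.filter_ssubset.2 ⟨x, ?_, lt_irrefl x⟩
    exact Finset.mem_filter.2 ⟨hx, fun c _ => ⟨id, id⟩⟩
  have hφ : ∀ x ∈ E, x ∉ C → φ x ∈ gap S.toFinset x := by
    intro x hx hxC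
    simp only [φ, hxC, if_false]
    exact nthElement_mem (hrank x hx) x
  have hgap : ∀ x ∈ E, x ∉ C → SameGap C x (φ x) := fun x hx hxC =>
    (Finset.mem_filter.1 (hφ x hx hxC)).2
  refine ⟨φ, ⟨?_, fun c hc => .inr hc, hfix⟩, fun x hx => ?_⟩
  · intro x hx y hy hxy
    by_cases hxC : x ∈ C <;> by_cases hyC : y ∈ C
    · rwa [hfix x hxC, hfix y hyC]
    · rw [hfix x hxC]
      exact (hgap y (hy.resolve_right hyC) hyC x hxC).1 hxy
    · rw [hfix y hyC]
      exact (hgap x (hx.resolve_right hxC) hxC y hyC).2 hxy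
    · have hxE := hx.resolve_right hxC
      have hyE := hy.resolve_right hyC
      -- A separating constant also separates the images. Without one, `x` and `y` share their gap,
      -- and the rank of `y` is larger because it counts `x`.
      by_cases hc : ∃ c ∈ C, x < c ∧ c < y
      · obtain ⟨c, hc, h1, h2⟩ := hc
        exact ((hgap x hxE hxC c hc).2 h1).trans ((hgap y hyE hyC c hc).1 h2)
      · push Not at hc
        have e : SameGap C x = SameGap C y := by
          funext s
          refine propext (forall₂_congr fun c hcC => ?_)
          have e1 : c < x ↔ c < y := ⟨fun h' => h'.trans hxy, fun h' => by
            by_contra hcx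
            rcases (not_lt.1 hcx).lt_or_eq with h'' | rfl
            · exact absurd h' (hc c hcC h'').not_gt
            · exact hxC hcC⟩
          have e2 : x < c ↔ y < c := ⟨fun h' => (hc c hcC h').lt_of_ne fun e => hyC (e ▸ hcC),
            fun h' => hxy.trans h'⟩
          rw [e1, e2]
        have eg : ∀ T, gap T x = gap T y := fun T => by simp only [gap, e]
        simp only [φ, hxC, hyC, if_false, eg]
        refine nthElement_lt (Finset.card_lt_card ?_) (hrank y hyE) x y
        rw [eg]
        refine Finset.ssubset_iff_subset_ne.2 ⟨Finset.monotone_filter_right _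
          fun z _ hz => lt_trans hz hxy, fun e' => ?_⟩
        have hm : x ∈ (gap E y).filter (· < y) := by
          refine Finset.mem_filter.2 ⟨?_, hxy⟩
          rw [← eg]
          exact Finset.mem_filter.2 ⟨hxE, fun c _ => ⟨id, id⟩⟩
        rw [← e'] at hm
        exact lt_irrefl x (Finset.mem_filter.1 hm).2
  · by_cases hxC : x ∈ C
    · rw [hfix x hxC]
      exact h.1 x hxC
    · exact List.mem_toFinset.1 (Finset.mem_filter.1 (hφ x hx hxC)).1

/-- Add to `C`, for each of the finitely many pairs of bounds and each `n ≤ N`, a set of `n`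
elements in the interval whenever there is one. -/
theorem exists_adequate (N : ℕ) (C : List I) : ∃ S, Adequate N C S := by
  classical
  let P (a b : Option I) (n : ℕ) (s : Finset I) : Prop := s.card = n ∧
    ∀ x ∈ s, (∀ c, a = some c → c < x) ∧ (∀ c, b = some c → x < c)
  let pick (a b : Option I) (n : ℕ) : Finset I := if h : ∃ s, P a b n s then h.choose else ∅
  refine ⟨C ++ (none :: C.map some).flatMap fun a => (none :: C.map some).flatMap fun b =>
    (List.range (N + 1)).flatMap fun n => (pick a b n).toList, fun c hc => by simp [hc], ?_⟩
  intro a ha b hb n hn hs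
  have hp : P a b n (pick a b n) := by
    simp only [pick, dif_pos (show ∃ s, P a b n s from hs)]
    exact Exists.choose_spec (p := P a b n) hs
  rw [← List.card_toFinset, ← hp.1]
  refine Finset.card_le_card fun x hx => ?_
  have h2 := hp.2 x hx
  simp only [listBetween, List.mem_toFinset, List.mem_filter, decide_eq_true_eq, Option.mem_toList]
  refine ⟨List.mem_append_right _ (List.mem_flatMap.2 ⟨a, ha, List.mem_flatMap.2 ⟨b, hb,
    List.mem_flatMap.2 ⟨n, hn, Finset.mem_toList.2 hx⟩⟩⟩), h2⟩

end Gaps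

/-! ### Reduction of bounded equivalence to the finite test -/

section Main

variable {I : Type*} {k : ℕ}

theorem mem_groundAtoms {s : List (ℕ × ℕ)} {w : List I} {a : ℕ × List I} :
    a ∈ groundAtoms s w ↔ (a.1, a.2.length) ∈ s ∧ ∀ x ∈ a.2, x ∈ w := by
  obtain ⟨p, l⟩ := a
  simp only [groundAtoms, List.mem_flatMap, List.mem_map, List.mem_words]
  constructor
  · rintro ⟨⟨_, _⟩, hs, l', ⟨rfl, hl⟩, ⟨⟩⟩
    exact ⟨hs, hl⟩
  · exact fun ⟨h1, h2⟩ => ⟨_, h1, l, ⟨rfl, h2⟩, rfl⟩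

variable [LinearOrder I]

theorem Condition.holds_filter {A : Condition I} {D : Database I} {s : List (ℕ × ℕ)}
    (hs : A.signature ⊆ s) (γ : ℕ → I) :
    A.Holds (D.filter fun a => (a.1, a.2.length) ∈ s) γ ↔ A.Holds D γ := by
  have key : ∀ a, a ∈ A.pos ∨ a ∈ A.neg →
      (a.Holds (D.filter fun a => (a.1, a.2.length) ∈ s) γ ↔ a.Holds D γ) := by
    intro a ha
    have : (a.pred, a.args.length) ∈ s := hs (List.mem_map.2 ⟨a, List.mem_append.2 ha, rfl⟩)
    simp [RelAtom.Holds, this]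
  exact and_congr (forall₂_congr fun a ha => key a (.inl ha))
    (and_congr (forall₂_congr fun a ha => not_congr (key a (.inr ha))) Iff.rfl)

theorem Database.carrier_mono {D D' : Database I} (h : D ⊆ D') : D.carrier ⊆ D'.carrier :=
  Finset.biUnion_subset_biUnion_of_subset_left _ h

variable [Nonempty I]

/-- Deleting atoms may shrink the carrier from which `assignments` takes its values. By safety this
is no restriction, so only the truth of the condition matters, and it ignores foreign predicate
symbols. -/
theorem Query.bag_filter {q : Query I k} (hq : q.Safe) (D : Database I) {s : List (ℕ × ℕ)}
    (hs : q.signature ⊆ s) (d : List I) :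
    q.bag (D.filter fun a => (a.1, a.2.length) ∈ s) d = q.bag D d := by
  unfold Query.bag
  congr 1
  refine List.map_congr_left fun A hA => ?_
  have e : A.assignments (D.filter fun a => (a.1, a.2.length) ∈ s) = A.assignments D := by
    ext γ
    rw [A.mem_assignments (hq A hA).1, A.mem_assignments (hq A hA).1]
    exact Condition.holds_filter (fun x hx => hs (List.mem_flatMap.2 ⟨A, hA, hx⟩)) _
  rw [e]

theorem equivalentWithin_iff {V : Type*} {α : Multiset (Fin k → I) → V} (hα : Shiftable α)
    {N : ℕ} {q q' : Query I k} (hq : q.Safe) (hq' : q'.Safe) {S : List I}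
    (hS : Adequate N (Classical.arbitrary I :: (q.constList ++ q'.constList)) S) :
    EquivalentWithin α N q q' S ↔ NEquivalent α N q q' := by
  constructor
  · intro h D hD
    set sig := q.signature ++ q'.signature with hsig
    -- Only atoms with a predicate symbol of `q` or `q'` occur in the enumerated databases.
    set D₀ : Database I := D.filter fun a => (a.1, a.2.length) ∈ sig with hD₀
    have hcard : D₀.carrier.card ≤ N :=
      (Finset.card_le_card (Database.carrier_mono (Finset.filter_subset _ _))).trans hD
    have hres : q.result α D₀ = q'.result α D₀ := by
      obtain ⟨φ, hφ, hφS⟩ := hS.exists_fixingEmbedding hcard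
      refine hφ.result_eq hα (fun x hx => .inl hx) ?_
      have hcard' : (D₀.map φ).carrier.card ≤ N := by
        rw [Database.carrier_map]
        exact Finset.card_image_le.trans hcard
      -- The words have length exactly `N`, so a smaller carrier is padded with the default element,
      -- which lies in `S`.
      let w : List I := (D₀.map φ).carrier.toList ++
        List.replicate (N - (D₀.map φ).carrier.card) (Classical.arbitrary I)
      have hw : w ∈ S.words N := by
        refine List.mem_words.2 ⟨by simp [w]; omega, fun x hx => ?_⟩
        rcases List.mem_append.1 hx with hx | hx
        · rw [Finset.mem_toList, Database.carrier_map, Finset.mem_image] at hx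
          obtain ⟨y, hy, rfl⟩ := hx
          exact hφS y hy
        · rw [List.eq_of_mem_replicate hx]
          exact hS.1 _ List.mem_cons_self
      have := h w hw ((groundAtoms sig w).filter fun a => a ∈ D₀.map φ)
        (List.mem_sublists'.2 List.filter_sublist)
      rw [agreeOn_iff] at this
      convert this using 2 <;>
      · ext a
        simp only [List.mem_toFinset, List.mem_filter, decide_eq_true_eq, mem_groundAtoms]
        refine ⟨fun ha => ⟨⟨?_, fun x hx => ?_⟩, ha⟩, fun ha => ha.2⟩
        · obtain ⟨b, hb, rfl⟩ := Finset.mem_image.1 ha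
          simpa using (Finset.mem_filter.1 hb).2
        · exact List.mem_append_left _ (Finset.mem_toList.2 (Database.mem_carrier.2 ⟨a, ha, hx⟩))
    simpa only [Query.result, hD₀, q.bag_filter hq D (List.subset_append_left _ _),
      q'.bag_filter hq' D (List.subset_append_right _ _), hsig] using hres
  -- Conversely, every tested database has its constants in a word of length `N`, so its carrier has
  -- at most `N` elements.
  · intro h w hw L hL
    rw [agreeOn_iff]
    refine h _ ((Finset.card_le_card (t := w.toFinset) fun x hx => ?_).trans
      ((List.toFinset_card_le w).trans (List.mem_words.1 hw).1.le))
    obtain ⟨a, ha, hx⟩ := Database.mem_carrier.1 hx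
    exact List.mem_toFinset.2
      ((mem_groundAtoms.1 ((List.mem_sublists'.1 hL).subset (List.mem_toFinset.1 ha))).2 x hx)

end Main

end AggQuery

theorem mainTheorem7 {I : Type*} [LinearOrder I] [Nonempty I] [Primcodable I]
    (hI : AggQuery.EffectiveOrder I) {k : ℕ} {V : Type*}
    (α : Multiset (Fin k → I) → V) (hα : AggQuery.EffectiveAggregation α)
    (hshift : AggQuery.Shiftable α) :
    AggQuery.BoundedEquivalenceDecidable α := by
  classical
  let C (x : ℕ × AggQuery.Query I k × AggQuery.Query I k) : List I :=
    Classical.arbitrary I :: (x.2.1.constList ++ x.2.2.constList)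
  have hC : Computable C := by fun_prop
  -- The adequate list must be a computable function of the input; existence together with
  -- decidability of adequacy gives this by search.
  obtain ⟨S, hS, hS'⟩ := ComputablePred.exists_choice
    (p := fun (x : ℕ × AggQuery.Query I k × AggQuery.Query I k) S => AggQuery.Adequate x.1 (C x) S)
    (hI.computablePred_adequate (by fun_prop) (by fun_prop) (by fun_prop))
    fun x => AggQuery.exists_adequate _ _
  have hdec := hI.computablePred_equivalentWithin hα
    (N := fun x : ℕ × AggQuery.Query I k × AggQuery.Query I k => x.1)
    (q := fun x => x.2.1) (q' := fun x => x.2.2) (S := S)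
    (by fun_prop) (by fun_prop) (by fun_prop) hS
  refine ⟨_, hdec.decide_comp, fun N q q' _ hq hq' => ?_⟩
  rw [decide_eq_true_eq]
  exact AggQuery.equivalentWithin_iff hshift hq hq' (hS' (N, q, q'))
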